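/- Let $k$ be a field. A dialgebra over $k$ is a $k$-linear space $D$ with two bilinear associative products $\dashv,\vdash$ such that $$a\dashv(b\vdash c)=(a\dashv b)\dashv c,\qquad (a\dashv b)\vdash c=(a\vdash b)\vdash c,\qquad a\vdash(b\dashv c)=(a\vdash b)\dashv c$$ for all $a,b,c\in D$. A Leibniz algebra over $k$ is a $k$-linear space $L$ with a bilinear bracket such that $[[a,b],c]=[[a,c],b]+[a,[b,c]]$ for all $a,b,c\in L$. Every dialgebra is a Leibniz algebra under $[a,b]=a\dashv b-b\vdash a$. A universal enveloping dialgebra of a Leibniz algebra $L$ is a dialgebra $U(L)$ together with a Leibniz homomorphism $\varepsilon:L\to U(L)$ such that for every dialgebra $D$ and every Leibniz homomorphism $\delta:L\to D$ there is exactly one dialgebra homomorphism $f:U(L)\to D$ with $f\varepsilon=\delta$. Let $L$ be a Leibniz algebra over $k$, of arbitrary dimension, and let $L_0$ be the subspace of $L$ spanned by all $[a,a]$ and all $[a,b]+[b,a]$ with $a,b\in L$; it is an ideal, and $L/L_0$ is a Lie algebra. Then $L$ has a universal enveloping dialgebra, and for every universal enveloping dialgebra $U(L)$ of $L$ there is an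 isomorphism of $k$-linear spaces $$U(L)\;\cong\;L\otimes_k U(L/L_0),$$ where $U(L/L_0)$ is the (associative, unital) universal enveloping algebra of the Lie algebra $L/L_0$. -/

import Mathlib

universe u v w t

open scoped TensorProduct

/-- A dialgebra over a field `k`: a `k`-linear space with two bilinear associative products,
`dashv a b` (written `a ⊣ b`) and `vdash a b` (written `a ⊢ b`), subject to the three mixed laws
`a ⊣ (b ⊢ c) = a ⊣ b ⊣ c`, `(a ⊣ b) ⊢ c = a ⊢ b ⊢ c` and `a ⊢ (b ⊣ c) = (a ⊢ b) ⊣ c`. -/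
class Dialgebra (k : Type u) (D : Type v) [Field k] [AddCommGroup D] [Module k D] where
  dashv : D →ₗ[k] D →ₗ[k] D
  vdash : D →ₗ[k] D →ₗ[k] D
  dashv_assoc : ∀ a b c : D, dashv (dashv a b) c = dashv a (dashv b c)
  vdash_assoc : ∀ a b c : D, vdash (vdash a b) c = vdash a (vdash b c)
  dashv_vdash : ∀ a b c : D, dashv a (vdash b c) = dashv (dashv a b) c
  dashv_vdash' : ∀ a b c : D, vdash (dashv a b) c = vdash (vdash a b) c
  vdash_dashv : ∀ a b c : D, vdash a (dashv b c) = dashv (vdash a b) c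

/-- A (right) Leibniz algebra over a field `k`: a `k`-linear space with a bilinear bracket such
that `[[a,b],c] = [[a,c],b] + [a,[b,c]]`. -/
class LeibnizAlgebra (k : Type u) (L : Type v) [Field k] [AddCommGroup L] [Module k L] where
  bracket : L →ₗ[k] L →ₗ[k] L
  leibniz : ∀ a b c : L,
    bracket (bracket a b) c = bracket (bracket a c) b + bracket a (bracket b c)

/-- A homomorphism of dialgebras: a linear map that preserves both products. -/
structure DialgebraHom (k : Type u) (D : Type v) (E : Type w) [Field k]
    [AddCommGroup D] [Module k D] [Dialgebra k D]
    [AddCommGroup E] [Module k E] [Dialgebra k E] extends D →ₗ[k] E where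
  map_dashv : ∀ a b : D,
    toFun (Dialgebra.dashv (k := k) a b) = Dialgebra.dashv (k := k) (toFun a) (toFun b)
  map_vdash : ∀ a b : D,
    toFun (Dialgebra.vdash (k := k) a b) = Dialgebra.vdash (k := k) (toFun a) (toFun b)

/-- A homomorphism of Leibniz algebras: a linear map that preserves the bracket. -/
structure LeibnizHom (k : Type u) (L : Type v) (M : Type w) [Field k]
    [AddCommGroup L] [Module k L] [LeibnizAlgebra k L]
    [AddCommGroup M] [Module k M] [LeibnizAlgebra k M] extends L →ₗ[k] M where
  map_bracket : ∀ a b : L,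
    toFun (LeibnizAlgebra.bracket (k := k) a b)
      = LeibnizAlgebra.bracket (k := k) (toFun a) (toFun b)

section Commutator

variable (k : Type u) (D : Type v) [Field k] [AddCommGroup D] [Module k D] [Dialgebra k D]

/-- Every dialgebra is a Leibniz algebra under `[a,b] = a ⊣ b - b ⊢ a`. -/
instance Dialgebra.commutatorLeibniz : LeibnizAlgebra k D where
  bracket := Dialgebra.dashv - (Dialgebra.vdash (k := k) (D := D)).flip
  leibniz a b c := by
    simp only [LinearMap.sub_apply, LinearMap.flip_apply, map_sub, Dialgebra.dashv_assoc,
      Dialgebra.vdash_assoc, Dialgebra.dashv_vdash, Dialgebra.dashv_vdash',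
      Dialgebra.vdash_dashv]
    abel

theorem Dialgebra.commutatorLeibniz_bracket (a b : D) :
    LeibnizAlgebra.bracket (k := k) a b
      = Dialgebra.dashv (k := k) a b - Dialgebra.vdash (k := k) b a := rfl

end Commutator

/-- A dialgebra `U` with a Leibniz homomorphism `ε : L → U` is a universal enveloping dialgebra
of the Leibniz algebra `L` if every Leibniz homomorphism `δ` from `L` to a dialgebra `D` is
`f ∘ ε` for exactly one dialgebra homomorphism `f : U → D`. The dialgebras `D` that are tested
range over the universe `Type t`. -/
def IsUniversalEnvelopingDialgebra (k : Type u) (L : Type v) (U : Type w) [Field k]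
    [AddCommGroup L] [Module k L] [LeibnizAlgebra k L]
    [AddCommGroup U] [Module k U] [Dialgebra k U] (ε : LeibnizHom k L U) : Prop :=
  ∀ (D : Type t) [AddCommGroup D] [Module k D] [Dialgebra k D] (δ : LeibnizHom k L D),
    ∃! f : DialgebraHom k U D, ∀ x : L, f.toLinearMap (ε.toLinearMap x) = δ.toLinearMap x

namespace LeibnizAlgebra

variable (k : Type u) (L : Type v) [Field k] [AddCommGroup L] [Module k L] [LeibnizAlgebra k L]

/-- The subspace `L₀` of `L` spanned by all `[a,a]` and all `[a,b] + [b,a]`. -/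
def lieKernel : Submodule k L :=
  Submodule.span k
    ({x | ∃ a : L, x = bracket (k := k) a a} ∪
      {x | ∃ a b : L, x = bracket (k := k) a b + bracket (k := k) b a})

variable {L}

theorem bracket_self_mem (a : L) : bracket (k := k) a a ∈ lieKernel k L :=
  Submodule.subset_span (Or.inl ⟨a, rfl⟩)

theorem bracket_add_mem (a b : L) :
    bracket (k := k) a b + bracket (k := k) b a ∈ lieKernel k L :=
  Submodule.subset_span (Or.inr ⟨a, b, rfl⟩)

theorem bracket_eq_zero_of_mem (a : L) {z : L} (hz : z ∈ lieKernel k L) :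
    bracket (k := k) a z = 0 := by
  have h : lieKernel k L ≤ LinearMap.ker (bracket (k := k) a) := by
    refine Submodule.span_le.2 ?_
    rintro _ (⟨b, rfl⟩ | ⟨b, c, rfl⟩)
    · have := leibniz (k := k) a b b
      simpa using this
    · have h1 := leibniz (k := k) a b c
      have h2 := leibniz (k := k) a c b
      have h3 : bracket (k := k) a (bracket (k := k) b c)
          + bracket (k := k) a (bracket (k := k) c b) = 0 := by
        rw [h2] at h1
        rw [add_assoc, left_eq_add, add_comm] at h1
        exact h1
      simpa using h3
  exact h hz

theorem bracket_mem_of_mem {z : L} (hz : z ∈ lieKernel k L) (a : L) :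
    bracket (k := k) z a ∈ lieKernel k L := by
  have h := bracket_add_mem k z a
  rwa [bracket_eq_zero_of_mem k a hz, add_zero] at h

variable (L)

/-- The quotient space `L / L₀`. -/
abbrev LieQuotient : Type v := L ⧸ lieKernel k L

/-- The bracket that `L / L₀` inherits from `L`. -/
def quotientBracket : LieQuotient k L →ₗ[k] LieQuotient k L →ₗ[k] LieQuotient k L :=
  (lieKernel k L).liftQ
    { toFun := fun a => (lieKernel k L).liftQ ((lieKernel k L).mkQ ∘ₗ bracket (k := k) a)
        (fun z hz => by
          simp [bracket_eq_zero_of_mem k a hz])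
      map_add' := fun a b => by
        refine Submodule.linearMap_qext _ (LinearMap.ext fun x => ?_)
        simp
      map_smul' := fun c a => by
        refine Submodule.linearMap_qext _ (LinearMap.ext fun x => ?_)
        simp }
    (fun z hz => by
      refine Submodule.linearMap_qext _ (LinearMap.ext fun x => ?_)
      simpa using bracket_mem_of_mem k hz x)

theorem quotientBracket_mk (a b : L) :
    quotientBracket k L (Submodule.Quotient.mk a) (Submodule.Quotient.mk b)
      = Submodule.Quotient.mk (bracket (k := k) a b) := rfl

/-- `L / L₀` is a Lie ring under the inherited bracket. -/
instance instLieRing : LieRing (LieQuotient k L) where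
  bracket x y := quotientBracket k L x y
  add_lie x y z := by
    change quotientBracket k L (x + y) z = quotientBracket k L x z + quotientBracket k L y z
    simp
  lie_add x y z := by
    change quotientBracket k L x (y + z) = quotientBracket k L x y + quotientBracket k L x z
    simp
  lie_self x := by
    induction x using Submodule.Quotient.induction_on with
    | H a => exact (Submodule.Quotient.mk_eq_zero _).2 (bracket_self_mem k a)
  leibniz_lie x y z := by
    induction x using Submodule.Quotient.induction_on with
    | H a =>
    induction y using Submodule.Quotient.induction_on with
    | H b =>
    induction z using Submodule.Quotient.induction_on with
    | H c =>
    change (Submodule.Quotient.mk (bracket (k := k) a (bracket (k := k) b c))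
        : LieQuotient k L)
      = Submodule.Quotient.mk (bracket (k := k) (bracket (k := k) a b) c)
        + Submodule.Quotient.mk (bracket (k := k) b (bracket (k := k) a c))
    rw [← Submodule.Quotient.mk_add, Submodule.Quotient.eq]
    have h := (lieKernel k L).neg_mem (bracket_add_mem k (bracket (k := k) a c) b)
    rw [leibniz (k := k) a b c]
    convert h using 1
    abel

/-- `L / L₀` is a Lie algebra over `k`. -/
instance instLieAlgebra : LieAlgebra k (LieQuotient k L) where
  lie_smul c x y := (quotientBracket k L x).map_smul c y

end LeibnizAlgebra

/-! Write `A` for the enveloping algebra of `L / L₀`. If `M` is an `A`-bimodule and `μ : M → A` a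
bimodule map, then `m ⊣ n = m · μ n` and `m ⊢ n = μ m · n` make `M` a dialgebra. Here `M = L ⊗ A`
and `μ (x ⊗ a) = x a`; the right action is multiplication on `A`, and the left action is determined
by `y · (x ⊗ a) = x ⊗ y a - [x, y] ⊗ a`. This sign makes `μ` left linear (`y x = x y - [x, y]` in
`A`) and makes `x ↦ x ⊗ 1` a Leibniz homomorphism.

Given `δ : L → D`, the operators `d ↦ d ⊣ δ x` turn `D` into a right `A`-module, so `x ⊗ a ↦ δ x ·
a` is defined. It preserves `⊣` by `rightMulOn_envelopingMul` and `⊢` by `liftSpace_leftAction`. It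
is the only extension of `δ`, because the elements `x ⊗ 1` generate `L ⊗ A` under `⊣`.

Thus `L ⊗ A` is itself a universal enveloping dialgebra, and any other one is isomorphic to it by
the usual uniqueness argument. No basis of `A` is needed. -/

namespace LeibnizAlgebra

/-! ### The enveloping algebra of the Lie quotient. -/

section Enveloping

attribute [local instance] LieRing.ofAssociativeRing

variable (k : Type u) (L : Type v) [Field k] [AddCommGroup L] [Module k L] [LeibnizAlgebra k L]

/-- The universal enveloping algebra of the Lie algebra `L / L₀`. -/
abbrev LieEnveloping : Type (max u v) := UniversalEnvelopingAlgebra k (LieQuotient k L)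

/-- The canonical linear map from a Leibniz algebra `L` to the enveloping algebra of `L / L₀`. -/
def toEnveloping : L →ₗ[k] LieEnveloping k L :=
  (UniversalEnvelopingAlgebra.ι k : LieQuotient k L →ₗ⁅k⁆ LieEnveloping k L).toLinearMap ∘ₗ
    (lieKernel k L).mkQ

theorem toEnveloping_apply (x : L) :
    toEnveloping k L x = UniversalEnvelopingAlgebra.ι k (Submodule.Quotient.mk x) := rfl

theorem toEnveloping_bracket (x y : L) :
    toEnveloping k L (bracket (k := k) x y)
      = toEnveloping k L x * toEnveloping k L y - toEnveloping k L y * toEnveloping k L x := by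
  simp only [toEnveloping_apply, ← quotientBracket_mk]
  rw [← LieRing.of_associative_ring_bracket, ← LieHom.map_lie]
  rfl

variable {k L}
variable {B : Type*} [Ring B] [Algebra k B]

theorem lieKernel_le_ker (R : L →ₗ[k] B)
    (hR : ∀ x y, R (bracket (k := k) x y) = R x * R y - R y * R x) :
    lieKernel k L ≤ LinearMap.ker R := by
  refine Submodule.span_le.2 ?_
  rintro _ (⟨a, rfl⟩ | ⟨a, b, rfl⟩) <;> simp [hR]

/-- A linear map from `L` to an associative algebra that carries the bracket to the commutator
extends to the enveloping algebra of `L / L₀`. -/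
def liftEnveloping (R : L →ₗ[k] B)
    (hR : ∀ x y, R (bracket (k := k) x y) = R x * R y - R y * R x) :
    LieEnveloping k L →ₐ[k] B :=
  UniversalEnvelopingAlgebra.lift k
    { (lieKernel k L).liftQ R (lieKernel_le_ker R hR) with
      map_lie' := fun {x y} => by
        induction x using Submodule.Quotient.induction_on with
        | H a =>
        induction y using Submodule.Quotient.induction_on with
        | H b => exact hR a b }

@[simp]
theorem liftEnveloping_toEnveloping (R : L →ₗ[k] B)
    (hR : ∀ x y, R (bracket (k := k) x y) = R x * R y - R y * R x) (x : L) :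
    liftEnveloping R hR (toEnveloping k L x) = R x := by
  rw [toEnveloping_apply, liftEnveloping, UniversalEnvelopingAlgebra.lift_ι_apply]
  rfl

/-- The generators lift to a map from the enveloping algebra into the subalgebra `S` they generate.
Followed by the inclusion of `S`, it fixes the generators, so it is the identity and `S` is
everything. -/
theorem adjoin_range_toEnveloping :
    Algebra.adjoin k (Set.range (toEnveloping k L)) = ⊤ := by
  set S := Algebra.adjoin k (Set.range (toEnveloping k L)) with hS
  have hmem : ∀ x, toEnveloping k L x ∈ S := fun x => Algebra.subset_adjoin ⟨x, rfl⟩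
  let R : L →ₗ[k] S := (toEnveloping k L).codRestrict S.toSubmodule hmem
  have hR : ∀ x y, R (bracket (k := k) x y) = R x * R y - R y * R x := fun x y =>
    Subtype.ext (toEnveloping_bracket k L x y)
  have h : S.val.comp (liftEnveloping R hR) = AlgHom.id k _ := by
    refine UniversalEnvelopingAlgebra.hom_ext k (LieHom.ext fun x => ?_)
    induction x using Submodule.Quotient.induction_on with
    | H a =>
      change S.val (liftEnveloping R hR (toEnveloping k L a)) = toEnveloping k L a
      rw [liftEnveloping_toEnveloping]
      rfl
  refine Algebra.eq_top_iff.2 fun a => ?_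
  have := DFunLike.congr_fun h a
  rw [AlgHom.id_apply] at this
  rw [← this]
  exact (liftEnveloping R hR a).2

/-- Induction on the enveloping algebra of `L / L₀`, by multiplication with generators on the
right. -/
theorem envelopingAlgebra_induction {p : LieEnveloping k L → Prop} (one : p 1)
    (add : ∀ a b, p a → p b → p (a + b)) (smul : ∀ (r : k) a, p a → p (r • a))
    (mul_gen : ∀ a x, p a → p (a * toEnveloping k L x)) (a : LieEnveloping k L) : p a := by
  -- The property of `b` that right multiplication by `b` preserves `p` is closed under products,
  -- which `p` itself need not be; the result is its instance `c = 1`.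
  have key : ∀ b ∈ Algebra.adjoin k (Set.range (toEnveloping k L)), ∀ c, p c → p (c * b) := by
    intro b hb
    induction hb using Algebra.adjoin_induction with
    | mem b hb =>
      obtain ⟨x, rfl⟩ := hb
      exact fun c hc => mul_gen c x hc
    | algebraMap r =>
      intro c hc
      rw [← Algebra.commutes, ← Algebra.smul_def]
      exact smul r c hc
    | add b b' _ _ h h' =>
      intro c hc
      rw [mul_add]
      exact add _ _ (h c hc) (h' c hc)
    | mul b b' _ _ h h' =>
      intro c hc
      rw [← mul_assoc]
      exact h' _ (h c hc)
  simpa using key a (by rw [adjoin_range_toEnveloping]; trivial) 1 one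

end Enveloping

/-! ### The dialgebra built from a bimodule map. -/

section Model

variable (k : Type u) (L : Type v) [Field k] [AddCommGroup L] [Module k L] [LeibnizAlgebra k L]

/-- The space `L ⊗ U(L / L₀)` that carries the enveloping dialgebra of `L`. -/
abbrev EnvelopingSpace : Type (max u v) := L ⊗[k] LieEnveloping k L

/-- The map `x ⊗ a ↦ x a` from `L ⊗ U(L / L₀)` to `U(L / L₀)`. -/
def envelopingMul : EnvelopingSpace k L →ₗ[k] LieEnveloping k L :=
  TensorProduct.lift (LinearMap.mul k (LieEnveloping k L) ∘ₗ toEnveloping k L)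

@[simp]
theorem envelopingMul_tmul (x : L) (a : LieEnveloping k L) :
    envelopingMul k L (x ⊗ₜ a) = toEnveloping k L x * a := rfl

/-- The right action of `U(L / L₀)` on `L ⊗ U(L / L₀)`. -/
def rightAction : LieEnveloping k L →ₗ[k] Module.End k (EnvelopingSpace k L) :=
  LinearMap.lTensorHom L ∘ₗ (LinearMap.mul k (LieEnveloping k L)).flip

@[simp]
theorem rightAction_tmul (x : L) (a b : LieEnveloping k L) :
    rightAction k L b (x ⊗ₜ a) = x ⊗ₜ (a * b) := rfl

/-- The left action of a generator on `L ⊗ U(L / L₀)`: it sends `x ⊗ a` to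
`x ⊗ y a - [x, y] ⊗ a`. -/
def leftGenerator : L →ₗ[k] Module.End k (EnvelopingSpace k L) :=
  LinearMap.lTensorHom L ∘ₗ LinearMap.mul k (LieEnveloping k L) ∘ₗ toEnveloping k L -
    LinearMap.rTensorHom (LieEnveloping k L) ∘ₗ (bracket (k := k) (L := L)).flip

@[simp]
theorem leftGenerator_tmul (x y : L) (a : LieEnveloping k L) :
    leftGenerator k L y (x ⊗ₜ a)
      = x ⊗ₜ (toEnveloping k L y * a) - bracket (k := k) x y ⊗ₜ a := rfl

/-- The Leibniz identity says that `y ↦ -[·, y]` carries brackets to commutators. Left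
multiplication on the second factor does so too and commutes with operators on the first, so the sum
is again a representation. -/
theorem leftGenerator_bracket (x y : L) :
    leftGenerator k L (bracket (k := k) x y)
      = leftGenerator k L x * leftGenerator k L y
        - leftGenerator k L y * leftGenerator k L x := by
  refine TensorProduct.ext' fun z a => ?_
  have h := leibniz (k := k) z x y
  simp only [LinearMap.sub_apply, Module.End.mul_apply, leftGenerator_tmul, map_sub,
    toEnveloping_bracket, h, sub_mul, TensorProduct.tmul_sub, TensorProduct.add_tmul, mul_assoc]
  abel

/-- The left action of `U(L / L₀)` on `L ⊗ U(L / L₀)`. -/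
def leftAction : LieEnveloping k L →ₐ[k] Module.End k (EnvelopingSpace k L) :=
  liftEnveloping (leftGenerator k L) (leftGenerator_bracket k L)

@[simp]
theorem leftAction_toEnveloping (x : L) :
    leftAction k L (toEnveloping k L x) = leftGenerator k L x :=
  liftEnveloping_toEnveloping _ _ x

variable {k L}

theorem envelopingMul_rightAction (b : LieEnveloping k L) (m : EnvelopingSpace k L) :
    envelopingMul k L (rightAction k L b m) = envelopingMul k L m * b := by
  induction m using TensorProduct.induction_on with
  | zero => simp
  | tmul x a => simp [mul_assoc]
  | add m n hm hn => simp [hm, hn, add_mul]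

theorem rightAction_rightAction (a b : LieEnveloping k L) (m : EnvelopingSpace k L) :
    rightAction k L b (rightAction k L a m) = rightAction k L (a * b) m := by
  induction m using TensorProduct.induction_on with
  | zero => simp
  | tmul x a => simp [mul_assoc]
  | add m n hm hn => simp [hm, hn]

/-- On `x ⊗ a` this is `x y a - [x, y] a = y x a`, which explains the correction term in
`leftGenerator`. -/
theorem envelopingMul_leftGenerator (y : L) (m : EnvelopingSpace k L) :
    envelopingMul k L (leftGenerator k L y m) = toEnveloping k L y * envelopingMul k L m := by
  induction m using TensorProduct.induction_on with
  | zero => simp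
  | tmul x a => simp [toEnveloping_bracket, sub_mul, mul_assoc]
  | add m n hm hn => simp [hm, hn, mul_add]

theorem envelopingMul_leftAction (a : LieEnveloping k L) (m : EnvelopingSpace k L) :
    envelopingMul k L (leftAction k L a m) = a * envelopingMul k L m := by
  induction a using envelopingAlgebra_induction generalizing m with
  | one => simp
  | add a b ha hb => simp [ha, hb, add_mul]
  | smul r a ha => simp [ha]
  | mul_gen a x ha => simp [ha, envelopingMul_leftGenerator, mul_assoc]

theorem leftGenerator_rightAction (y : L) (b : LieEnveloping k L) (m : EnvelopingSpace k L) :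
    leftGenerator k L y (rightAction k L b m) = rightAction k L b (leftGenerator k L y m) := by
  induction m using TensorProduct.induction_on with
  | zero => simp
  | tmul x a => simp [mul_assoc]
  | add m n hm hn => simp [hm, hn]

theorem leftAction_rightAction (a b : LieEnveloping k L) (m : EnvelopingSpace k L) :
    leftAction k L a (rightAction k L b m) = rightAction k L b (leftAction k L a m) := by
  induction a using envelopingAlgebra_induction generalizing m with
  | one => simp
  | add a c ha hc => simp [ha, hc]
  | smul r a ha => simp [ha]
  | mul_gen a x ha => simp [ha, leftGenerator_rightAction]

/-- The dialgebra structure on `L ⊗ U(L / L₀)`. -/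
instance : Dialgebra k (EnvelopingSpace k L) where
  dashv := (rightAction k L ∘ₗ envelopingMul k L).flip
  vdash := (leftAction k L).toLinearMap ∘ₗ envelopingMul k L
  dashv_assoc a b c := by simp [envelopingMul_rightAction, rightAction_rightAction]
  vdash_assoc a b c := by simp [envelopingMul_leftAction]
  dashv_vdash a b c := by simp [envelopingMul_leftAction, rightAction_rightAction]
  dashv_vdash' a b c := by simp [envelopingMul_leftAction, envelopingMul_rightAction]
  vdash_dashv a b c := by simp [leftAction_rightAction]

theorem dashv_eq_rightAction (m n : EnvelopingSpace k L) :
    Dialgebra.dashv (k := k) m n = rightAction k L (envelopingMul k L n) m := rfl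

theorem vdash_eq_leftAction (m n : EnvelopingSpace k L) :
    Dialgebra.vdash (k := k) m n = leftAction k L (envelopingMul k L m) n := rfl

variable (k L) in
/-- The Leibniz homomorphism `x ↦ x ⊗ 1`. -/
def toEnvelopingSpace : LeibnizHom k L (EnvelopingSpace k L) where
  toLinearMap := (TensorProduct.mk k L (LieEnveloping k L)).flip 1
  map_bracket x y := by
    change (bracket (k := k) x y ⊗ₜ 1 : EnvelopingSpace k L)
      = Dialgebra.dashv (k := k) (x ⊗ₜ 1 : EnvelopingSpace k L) (y ⊗ₜ 1)
        - Dialgebra.vdash (k := k) (y ⊗ₜ 1 : EnvelopingSpace k L) (x ⊗ₜ 1)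
    -- The two products are `x ⊗ y` and `x ⊗ y - [x, y] ⊗ 1`.
    simp [dashv_eq_rightAction, vdash_eq_leftAction]

end Model

/-! ### Extension of a Leibniz homomorphism to the model. -/

section Lift

variable {k : Type u} {L : Type v} [Field k] [AddCommGroup L] [Module k L] [LeibnizAlgebra k L]
variable {D : Type t} [AddCommGroup D] [Module k D] [Dialgebra k D]

theorem map_bracket_eq (δ : LeibnizHom k L D) (x y : L) :
    δ.toLinearMap (bracket (k := k) x y)
      = Dialgebra.dashv (k := k) (δ.toLinearMap x) (δ.toLinearMap y)
        - Dialgebra.vdash (k := k) (δ.toLinearMap y) (δ.toLinearMap x) :=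
  δ.map_bracket x y

/-- A Leibniz homomorphism `δ : L → D` makes `D` a right module over `U(L / L₀)`, the class of `x`
acting by `d ↦ d ⊣ δ x`. -/
def rightActionOn (δ : LeibnizHom k L D) : LieEnveloping k L →ₐ[k] (Module.End k D)ᵐᵒᵖ :=
  liftEnveloping
    ((MulOpposite.opLinearEquiv k).toLinearMap ∘ₗ
      (Dialgebra.dashv (k := k) (D := D)).flip ∘ₗ δ.toLinearMap)
    (fun x y => by
      -- Evaluated at `d`, the term `d ⊣ (δ y ⊢ δ x)` of `d ⊣ δ [x, y]` becomes `(d ⊣ δ y) ⊣ δ x` by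
      -- the mixed law, which leaves a commutator of right operators.
      refine MulOpposite.unop_injective (LinearMap.ext fun d => ?_)
      simp [map_bracket_eq, Dialgebra.dashv_vdash, Dialgebra.dashv_assoc])

/-- The right action of `a` on `D`. -/
def rightMulOn (δ : LeibnizHom k L D) : LieEnveloping k L →ₗ[k] D →ₗ[k] D :=
  (MulOpposite.opLinearEquiv k).symm.toLinearMap ∘ₗ (rightActionOn δ).toLinearMap

@[simp]
theorem rightMulOn_one (δ : LeibnizHom k L D) (d : D) : rightMulOn δ 1 d = d := by
  simp [rightMulOn]

theorem rightMulOn_mul (δ : LeibnizHom k L D) (a b : LieEnveloping k L) (d : D) :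
    rightMulOn δ (a * b) d = rightMulOn δ b (rightMulOn δ a d) := by
  simp [rightMulOn]

@[simp]
theorem rightMulOn_toEnveloping (δ : LeibnizHom k L D) (x : L) (d : D) :
    rightMulOn δ (toEnveloping k L x) d = Dialgebra.dashv (k := k) d (δ.toLinearMap x) := by
  simp [rightMulOn, rightActionOn]

theorem rightMulOn_vdash (δ : LeibnizHom k L D) (a : LieEnveloping k L) (d e : D) :
    rightMulOn δ a (Dialgebra.vdash (k := k) d e)
      = Dialgebra.vdash (k := k) d (rightMulOn δ a e) := by
  induction a using envelopingAlgebra_induction with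
  | one => simp
  | add a b ha hb => simp [ha, hb]
  | smul r a ha => simp [ha]
  | mul_gen a x ha => simp [rightMulOn_mul, ha, Dialgebra.vdash_dashv]

theorem rightMulOn_dashv (δ : LeibnizHom k L D) (a : LieEnveloping k L) (d e : D) :
    rightMulOn δ a (Dialgebra.dashv (k := k) d e)
      = Dialgebra.dashv (k := k) d (rightMulOn δ a e) := by
  induction a using envelopingAlgebra_induction with
  | one => simp
  | add a b ha hb => simp [ha, hb]
  | smul r a ha => simp [ha]
  | mul_gen a x ha => simp [rightMulOn_mul, ha, Dialgebra.dashv_assoc]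

/-- The linear map `x ⊗ a ↦ δ x · a`. -/
def liftSpace (δ : LeibnizHom k L D) : EnvelopingSpace k L →ₗ[k] D :=
  TensorProduct.lift ((rightMulOn δ).flip ∘ₗ δ.toLinearMap)

@[simp]
theorem liftSpace_tmul (δ : LeibnizHom k L D) (x : L) (a : LieEnveloping k L) :
    liftSpace δ (x ⊗ₜ a) = rightMulOn δ a (δ.toLinearMap x) := rfl

theorem liftSpace_rightAction (δ : LeibnizHom k L D) (a : LieEnveloping k L)
    (m : EnvelopingSpace k L) :
    liftSpace δ (rightAction k L a m) = rightMulOn δ a (liftSpace δ m) := by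
  induction m using TensorProduct.induction_on with
  | zero => simp
  | tmul x b => simp [rightMulOn_mul]
  | add m n hm hn => simp [hm, hn]

/-- For `n = x ⊗ a`, `d · (x a) = (d ⊣ δ x) · a = d ⊣ (δ x · a)`. This is compatibility with `⊣`. -/
theorem rightMulOn_envelopingMul (δ : LeibnizHom k L D) (n : EnvelopingSpace k L) (d : D) :
    rightMulOn δ (envelopingMul k L n) d = Dialgebra.dashv (k := k) d (liftSpace δ n) := by
  induction n using TensorProduct.induction_on with
  | zero => simp
  | tmul x a => simp [rightMulOn_mul, rightMulOn_dashv]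
  | add m n hm hn => simp [hm, hn]

/-- Since `δ [x, y] = δ x ⊣ δ y - δ y ⊢ δ x`, the terms `(δ x ⊣ δ y) · a` cancel and `(δ y ⊢ δ x) ·
a = δ y ⊢ (δ x · a)` remains. -/
theorem liftSpace_leftGenerator (δ : LeibnizHom k L D) (y : L) (m : EnvelopingSpace k L) :
    liftSpace δ (leftGenerator k L y m)
      = Dialgebra.vdash (k := k) (δ.toLinearMap y) (liftSpace δ m) := by
  induction m using TensorProduct.induction_on with
  | zero => simp
  | tmul x a => simp [rightMulOn_mul, map_bracket_eq, rightMulOn_vdash]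
  | add m n hm hn => simp [hm, hn]

/-- To the left of `⊢`, the products `⊣` inside `δ x · a` may be replaced by `⊢`, so `δ x · a` acts
as the successive operators of its generators. The factor `x` is needed because `D` has no unit to
represent `a` alone. -/
theorem liftSpace_leftAction_mul (δ : LeibnizHom k L D) (x : L) (a : LieEnveloping k L)
    (n : EnvelopingSpace k L) :
    liftSpace δ (leftAction k L (toEnveloping k L x * a) n)
      = Dialgebra.vdash (k := k) (rightMulOn δ a (δ.toLinearMap x)) (liftSpace δ n) := by
  induction a using envelopingAlgebra_induction generalizing n with
  | one => simp [liftSpace_leftGenerator]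
  | add a b ha hb => simp only [mul_add, map_add, LinearMap.add_apply, ha, hb]
  | smul r a ha => simp only [mul_smul_comm, map_smul, LinearMap.smul_apply, ha]
  -- The last generator `y` acts on `n` first, so the induction hypothesis is applied to `y · n`.
  | mul_gen a y ha =>
    rw [← mul_assoc, map_mul, Module.End.mul_apply, leftAction_toEnveloping, ha,
      liftSpace_leftGenerator, rightMulOn_mul, rightMulOn_toEnveloping,
      Dialgebra.dashv_vdash', Dialgebra.vdash_assoc]

theorem liftSpace_leftAction (δ : LeibnizHom k L D) (m n : EnvelopingSpace k L) :
    liftSpace δ (leftAction k L (envelopingMul k L m) n)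
      = Dialgebra.vdash (k := k) (liftSpace δ m) (liftSpace δ n) := by
  induction m using TensorProduct.induction_on with
  | zero => simp
  | tmul x a => exact liftSpace_leftAction_mul δ x a n
  | add m m' hm hn => simp only [map_add, LinearMap.add_apply, hm, hn]

/-- The dialgebra homomorphism `x ⊗ a ↦ δ x · a`. -/
def liftDialgebraHom (δ : LeibnizHom k L D) : DialgebraHom k (EnvelopingSpace k L) D where
  toLinearMap := liftSpace δ
  map_dashv m n := by
    change liftSpace δ (rightAction k L (envelopingMul k L n) m) = _
    rw [liftSpace_rightAction, rightMulOn_envelopingMul]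
    rfl
  map_vdash m n := liftSpace_leftAction δ m n

end Lift

/-! ### The universal property of the model. -/

section Universal

variable (k : Type u) (L : Type v) [Field k] [AddCommGroup L] [Module k L] [LeibnizAlgebra k L]

variable {k L} in
theorem dialgebraHom_tmul_eq {D : Type t} [AddCommGroup D] [Module k D] [Dialgebra k D]
    (δ : LeibnizHom k L D) (f : DialgebraHom k (EnvelopingSpace k L) D)
    (hf : ∀ x, f.toLinearMap ((toEnvelopingSpace k L).toLinearMap x) = δ.toLinearMap x)
    (x : L) (a : LieEnveloping k L) :
    f.toLinearMap (x ⊗ₜ a) = rightMulOn δ a (δ.toLinearMap x) := by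
  induction a using envelopingAlgebra_induction with
  | one => exact (hf x).trans (rightMulOn_one δ _).symm
  | add a b ha hb => rw [TensorProduct.tmul_add, map_add, map_add, ha, hb, LinearMap.add_apply]
  | smul r a ha => rw [TensorProduct.tmul_smul, map_smul, map_smul, ha, LinearMap.smul_apply]
  | mul_gen a y ha =>
    -- The element `x ⊗ a y` is `(x ⊗ a) ⊣ (y ⊗ 1)`, so the value of `f` on it is forced.
    have h := f.map_dashv (x ⊗ₜ a) (y ⊗ₜ 1)
    rw [dashv_eq_rightAction, envelopingMul_tmul, mul_one, rightAction_tmul] at h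
    rw [rightMulOn_mul, ← ha, rightMulOn_toEnveloping, ← hf y]
    exact h

theorem isUniversalEnvelopingDialgebra_toEnvelopingSpace :
    IsUniversalEnvelopingDialgebra.{u, v, max u v, t} k L (EnvelopingSpace k L)
      (toEnvelopingSpace k L) := by
  intro D _ _ _ δ
  refine ⟨liftDialgebraHom δ, fun x => ?_, fun f hf => ?_⟩
  · change liftSpace δ (x ⊗ₜ 1) = _
    simp
  · have h : f.toLinearMap = (liftDialgebraHom δ).toLinearMap :=
      TensorProduct.ext' fun x a => dialgebraHom_tmul_eq δ f hf x a
    cases f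
    cases h
    rfl

end Universal

end LeibnizAlgebra

/-! ### Transport of dialgebras to a larger universe. -/

section ULift

variable {k : Type u} {D : Type v} [Field k] [AddCommGroup D] [Module k D] [Dialgebra k D]

instance ULift.instDialgebra : Dialgebra k (ULift.{w} D) where
  dashv := (Dialgebra.dashv (k := k) (D := D)).compr₂ ULift.moduleEquiv.symm.toLinearMap |>.compl₁₂
    ULift.moduleEquiv.toLinearMap ULift.moduleEquiv.toLinearMap
  vdash := (Dialgebra.vdash (k := k) (D := D)).compr₂ ULift.moduleEquiv.symm.toLinearMap |>.compl₁₂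
    ULift.moduleEquiv.toLinearMap ULift.moduleEquiv.toLinearMap
  dashv_assoc a b c := congrArg ULift.up (Dialgebra.dashv_assoc a.down b.down c.down)
  vdash_assoc a b c := congrArg ULift.up (Dialgebra.vdash_assoc a.down b.down c.down)
  dashv_vdash a b c := congrArg ULift.up (Dialgebra.dashv_vdash a.down b.down c.down)
  dashv_vdash' a b c := congrArg ULift.up (Dialgebra.dashv_vdash' a.down b.down c.down)
  vdash_dashv a b c := congrArg ULift.up (Dialgebra.vdash_dashv a.down b.down c.down)

variable {E : Type t} [AddCommGroup E] [Module k E] [Dialgebra k E]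

/-- Composition of a dialgebra homomorphism with the embedding in a larger universe. -/
def DialgebraHom.uliftUp (f : DialgebraHom k E D) : DialgebraHom k E (ULift.{w} D) where
  toLinearMap := ULift.moduleEquiv.symm.toLinearMap ∘ₗ f.toLinearMap
  map_dashv a b := congrArg ULift.up (f.map_dashv a b)
  map_vdash a b := congrArg ULift.up (f.map_vdash a b)

/-- Descent of a dialgebra homomorphism from a larger universe. -/
def DialgebraHom.uliftDown (f : DialgebraHom k E (ULift.{w} D)) : DialgebraHom k E D where
  toLinearMap := ULift.moduleEquiv.toLinearMap ∘ₗ f.toLinearMap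
  map_dashv a b := congrArg ULift.down (f.map_dashv a b)
  map_vdash a b := congrArg ULift.down (f.map_vdash a b)

/-- Composition of a Leibniz homomorphism with the embedding in a larger universe. -/
def LeibnizHom.uliftUp {L : Type t} [AddCommGroup L] [Module k L] [LeibnizAlgebra k L]
    (f : LeibnizHom k L D) : LeibnizHom k L (ULift.{w} D) where
  toLinearMap := ULift.moduleEquiv.symm.toLinearMap ∘ₗ f.toLinearMap
  map_bracket a b := congrArg ULift.up (f.map_bracket a b)

end ULift

/-! ### Uniqueness of the universal enveloping dialgebra. -/

section Uniqueness

universe r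

variable {k : Type u} [Field k]

/-- The identity homomorphism of a dialgebra. -/
def DialgebraHom.id (D : Type v) [AddCommGroup D] [Module k D] [Dialgebra k D] :
    DialgebraHom k D D where
  toLinearMap := LinearMap.id
  map_dashv _ _ := rfl
  map_vdash _ _ := rfl

/-- Composition of dialgebra homomorphisms. -/
def DialgebraHom.comp {D : Type v} {E : Type w} {F : Type t}
    [AddCommGroup D] [Module k D] [Dialgebra k D] [AddCommGroup E] [Module k E] [Dialgebra k E]
    [AddCommGroup F] [Module k F] [Dialgebra k F]
    (g : DialgebraHom k E F) (f : DialgebraHom k D E) : DialgebraHom k D F where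
  toLinearMap := g.toLinearMap ∘ₗ f.toLinearMap
  map_dashv a b := (congrArg g.toFun (f.map_dashv a b)).trans (g.map_dashv _ _)
  map_vdash a b := (congrArg g.toFun (f.map_vdash a b)).trans (g.map_vdash _ _)

variable {L : Type v} [AddCommGroup L] [Module k L] [LeibnizAlgebra k L]

/-- A universal enveloping dialgebra admits only one endomorphism over `L`. -/
theorem IsUniversalEnvelopingDialgebra.endomorphism_eq_id {U : Type w} [AddCommGroup U]
    [Module k U] [Dialgebra k U] {ε : LeibnizHom k L U}
    (h : IsUniversalEnvelopingDialgebra.{u, v, w, max w t} k L U ε) (f : DialgebraHom k U U)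
    (hf : ∀ x, f.toLinearMap (ε.toLinearMap x) = ε.toLinearMap x) (z : U) :
    f.toLinearMap z = z := by
  -- The tested universe may be larger than that of `U`, so `f` and the identity are compared after
  -- embedding `U` in it.
  have h' := (h (ULift.{t} U) ε.uliftUp).unique (y₁ := f.uliftUp)
    (y₂ := (DialgebraHom.id U).uliftUp) (fun x => congrArg ULift.up (hf x)) (fun x => rfl)
  exact congrArg (fun g : DialgebraHom k U (ULift.{t} U) => (g.toLinearMap z).down) h'

/-- A universal enveloping dialgebra maps over `L` to every dialgebra in a universe that embeds
in the one tested. -/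
theorem IsUniversalEnvelopingDialgebra.exists_lift {U : Type w} [AddCommGroup U]
    [Module k U] [Dialgebra k U] {ε : LeibnizHom k L U} {D : Type r} [AddCommGroup D]
    [Module k D] [Dialgebra k D]
    (h : IsUniversalEnvelopingDialgebra.{u, v, w, max r t} k L U ε) (δ : LeibnizHom k L D) :
    ∃ f : DialgebraHom k U D, ∀ x, f.toLinearMap (ε.toLinearMap x) = δ.toLinearMap x := by
  obtain ⟨f, hf, -⟩ := h (ULift.{t} D) δ.uliftUp
  exact ⟨f.uliftDown, fun x => congrArg ULift.down (hf x)⟩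

end Uniqueness

theorem mainTheorem3 (k : Type u) [Field k] (L : Type v) [AddCommGroup L] [Module k L]
    [LeibnizAlgebra k L] :
    (∃ (U : Type (max u v)) (_ : AddCommGroup U) (_ : Module k U) (_ : Dialgebra k U)
      (ε : LeibnizHom k L U),
      IsUniversalEnvelopingDialgebra.{u, v, max u v, max u v w} k L U ε) ∧
    ∀ (U : Type w) [AddCommGroup U] [Module k U] [Dialgebra k U] (ε : LeibnizHom k L U),
      IsUniversalEnvelopingDialgebra.{u, v, w, max u v w} k L U ε →
        Nonempty (U ≃ₗ[k]
          L ⊗[k] UniversalEnvelopingAlgebra k (LeibnizAlgebra.LieQuotient k L)) := by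
  refine ⟨⟨LeibnizAlgebra.EnvelopingSpace k L, inferInstance, inferInstance, inferInstance,
    LeibnizAlgebra.toEnvelopingSpace k L,
    LeibnizAlgebra.isUniversalEnvelopingDialgebra_toEnvelopingSpace k L⟩, ?_⟩
  intro U _ _ _ ε hU
  obtain ⟨f, hf⟩ := IsUniversalEnvelopingDialgebra.exists_lift.{u, v, w, w, max u v} hU
    (LeibnizAlgebra.toEnvelopingSpace k L)
  obtain ⟨g, hg, -⟩ :=
    LeibnizAlgebra.isUniversalEnvelopingDialgebra_toEnvelopingSpace k L U ε
  -- Both composites are endomorphisms over `L` of a universal enveloping dialgebra, hence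
  -- identities.
  refine ⟨LinearEquiv.ofLinearMap f.toLinearMap g.toLinearMap (LinearMap.ext fun m => ?_)
    (LinearMap.ext fun z => ?_)⟩
  · exact IsUniversalEnvelopingDialgebra.endomorphism_eq_id.{u, v, max u v, max u v}
      (LeibnizAlgebra.isUniversalEnvelopingDialgebra_toEnvelopingSpace k L) (f.comp g)
      (fun x => (congrArg f.toLinearMap (hg x)).trans (hf x)) m
  · exact IsUniversalEnvelopingDialgebra.endomorphism_eq_id.{u, v, w, max u v} hU (g.comp f)
      (fun x => (congrArg g.toLinearMap (hf x)).trans (hg x)) z
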